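/- Let $n\ge 0$ and $[n]=\{1,\dots,n\}$. Let $S=\mathbb{R}[\mathcal{P}\cup\mathcal{A}]$ be the polynomial ring, graded with every unknown in degree $1$, in the unknowns $p_I$ for $I\subseteq[n]$ and $a_{ij|K}=a_{ji|K}$ for distinct $i,j\in[n]$ and $K\subseteq[n]\setminus\{i,j\}$. Let $\Sigma=(\sigma_{ij})$ be the symmetric $n\times n$ matrix whose entries $\sigma_{ij}=\sigma_{ji}$ are independent unknowns, and let $S\to\mathbb{R}[\Sigma]$ be the $\mathbb{R}$-algebra homomorphism that maps $p_I$ to the principal minor of $\Sigma$ with rows and columns $I$ (so $p_\emptyset\mapsto 1$), and $a_{ij|K}$ to the almost-principal minor of $\Sigma$ with row indices $i,K$ and column indices $j,K$ (with $i$, respectively $j$, listed first, followed by $K$ in increasing order). Let $J_n\subseteq S$ be the ideal generated by all homogeneous polynomials in the kernel of this homomorphism, let $(J_n)_2$ be the space of quadrics (homogeneous polynomials of degree $2$) in $J_n$, and let $\hat J_n=\langle (J_n)_2\rangle$ be the ideal of $S$ that it generates. **Proposition.** The projective variety $V(J_n)$ of principal and almost-principal minors of symmetric $n\times n$ matrices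 is defined scheme-theoretically by the quadrics in $J_n$. That is, the closed subschemes of $\operatorname{Proj} S$ defined by $J_n$ and by $\hat J_n$ are equal (they have the same ideal sheaf), and, equivalently, $\hat J_n$ and $J_n$ agree in all sufficiently large degrees: there is $D$ such that $(\hat J_n)_d=(J_n)_d$ for all $d\ge D$. -/

import Mathlib

noncomputable section

namespace GaussoidQuadrics

/-- Index set of the almost-principal unknowns `a_{ij|K}`: an unordered pair of distinct indices,
represented by `(i, j)` with `i < j`, and a set `K` containing neither `i` nor `j`. -/
abbrev AlmostPrincipalIndex (n : ℕ) : Type :=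
  {t : Fin n × Fin n × Finset (Fin n) // t.1 < t.2.1 ∧ t.1 ∉ t.2.2 ∧ t.2.1 ∉ t.2.2}

/-- Index set of all unknowns: `Sum.inl I` stands for `p_I`, `Sum.inr (i, j, K)` for `a_{ij|K}`. -/
abbrev MinorIndex (n : ℕ) : Type :=
  Finset (Fin n) ⊕ AlmostPrincipalIndex n

/-- The polynomial ring `ℝ[P ∪ A]` in the unknowns `p_I` and `a_{ij|K}`. -/
abbrev MinorRing (n : ℕ) : Type :=
  MvPolynomial (MinorIndex n) ℝ

/-- The generic symmetric `n × n` matrix `Σ`. Its entries `σ_{ij} = σ_{ji}` are the variables of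
the polynomial ring `ℝ[Σ]`, indexed by unordered pairs. -/
def genericSymm (n : ℕ) : Matrix (Fin n) (Fin n) (MvPolynomial (Sym2 (Fin n)) ℝ) :=
  Matrix.of fun i j => MvPolynomial.X s(i, j)

/-- The principal minor of `M` with row and column indices `I`. -/
def principalMinor {n : ℕ} {R : Type*} [CommRing R] (M : Matrix (Fin n) (Fin n) R)
    (I : Finset (Fin n)) : R :=
  (M.submatrix (fun k : I => (k : Fin n)) (fun k : I => (k : Fin n))).det

/-- The almost-principal minor of `M` with rows `i, K` and columns `j, K`, where `i` and `j` come
first and `K` is listed in the same order in rows and columns (so that the order of `K` does not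
affect the sign). Rows and columns are indexed by `Option K`, where `none` is the place of `i` in
the rows and of `j` in the columns. -/
def almostPrincipalMinor {n : ℕ} {R : Type*} [CommRing R] (M : Matrix (Fin n) (Fin n) R)
    (i j : Fin n) (K : Finset (Fin n)) : R :=
  (M.submatrix (fun k : Option K => k.elim i (fun l => (l : Fin n)))
    (fun k : Option K => k.elim j (fun l => (l : Fin n)))).det

/-- The homomorphism `ℝ[P ∪ A] → ℝ[Σ]` that sends each unknown to the corresponding minor of the
generic symmetric matrix. -/
def minorMap (n : ℕ) : MinorRing n →ₐ[ℝ] MvPolynomial (Sym2 (Fin n)) ℝ :=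
  MvPolynomial.aeval (Sum.elim
    (fun I => principalMinor (genericSymm n) I)
    (fun t => almostPrincipalMinor (genericSymm n) t.1.1 t.1.2.1 t.1.2.2))

/-- The standard grading of `ℝ[P ∪ A]`: every unknown has degree one. -/
abbrev grading (n : ℕ) : ℕ → Submodule ℝ (MinorRing n) :=
  MvPolynomial.homogeneousSubmodule (MinorIndex n) ℝ

instance gradedRingGrading (n : ℕ) : GradedRing (grading n) :=
  MvPolynomial.gradedAlgebra

/-- The homogeneous ideal `J_n`, generated by all homogeneous polynomials in the kernel of
`minorMap n`. -/
def J (n : ℕ) : HomogeneousIdeal (grading n) where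
  toSubmodule := Ideal.span {f | (∃ d : ℕ, f.IsHomogeneous d) ∧ minorMap n f = 0}
  is_homogeneous' := Ideal.homogeneous_span _ _ (by
    rintro f ⟨⟨d, hd⟩, -⟩
    exact ⟨d, hd⟩)

/-- The ideal generated by `(J_n)_2`, the space of all quadrics in `J_n`. -/
def quadricIdeal (n : ℕ) : HomogeneousIdeal (grading n) where
  toSubmodule := Ideal.span {f | f.IsHomogeneous 2 ∧ f ∈ J n}
  is_homogeneous' := Ideal.homogeneous_span _ _ (by
    rintro f ⟨hd, -⟩
    exact ⟨2, hd⟩)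

section ProjIdealSheaf

open AlgebraicGeometry

variable {A σ : Type} [CommRing A] [SetLike σ A] [AddSubgroupClass σ A]
  {𝒜 : ℕ → σ} [GradedRing 𝒜]

/-- For a homogeneous ideal `I` of `A` and a point `x` of `Proj A`, the ideal `(I_x)_0` of the
local ring `(A_x)_0` of homogeneous fractions of degree zero: the degree zero part of the extension
of `I` to the localization of `A` at the homogeneous prime `x`. -/
def stalkIdeal (I : HomogeneousIdeal 𝒜) (x : ProjectiveSpectrum 𝒜) :
    Ideal (HomogeneousLocalization.AtPrime 𝒜 x.asHomogeneousIdeal.toIdeal) :=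
  (I.toIdeal.map (algebraMap A (Localization.AtPrime x.asHomogeneousIdeal.toIdeal))).comap
    (algebraMap (HomogeneousLocalization.AtPrime 𝒜 x.asHomogeneousIdeal.toIdeal)
      (Localization.AtPrime x.asHomogeneousIdeal.toIdeal))

/-- The sections over `U` of the sheaf of ideals on `Proj A` associated with a homogeneous ideal
`I`, that is, of the ideal sheaf of the closed subscheme of `Proj A` defined by `I`. A section of
the structure sheaf belongs to it if all its germs lie in the ideals `(I_x)_0`. -/
def idealSheaf (I : HomogeneousIdeal 𝒜) (U : (Proj 𝒜).Opens) : Ideal Γ(Proj 𝒜, U) :=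
  ⨅ x : U, (stalkIdeal I x.1).comap
    ((Proj.stalkIso 𝒜 x.1).hom.hom.comp ((Proj 𝒜).presheaf.germ U x.1 x.2).hom)

end ProjIdealSheaf

end GaussoidQuadrics

end

/-! It suffices that for every unknown `x` and every `f` in `J n` some `x ^ N * f` lies in the
quadric ideal (`exists_X_pow_mul_mem`). Then the two ideals agree at every point of `Proj`, since
some unknown is invertible there, and Noetherianity gives agreement in large degrees.

On the chart where `p_∅` is invertible, row expansion of minors, homogenized with `p_∅`, gives
quadrics that recursively express every unknown as `p_∅` times the corresponding minor of the matrix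
with entries `a_{ij} / p_∅` (with `p_i` on the diagonal). A form of degree `d` in the kernel thus
becomes `p_∅ ^ d` times zero (`exists_X_empty_pow_mul_mem`).

The other charts follow by symmetry. Pivoting the symmetric matrix at a diagonal entry `k` permutes
the unknowns up to sign, and multiplies all minors by one common factor, so it preserves the
homogeneous kernel and its quadrics (`minorMap_pivotHom_eq_zero`). Pivots carry `p_∅` to every `p_I`
and `a_{ij|∅}` to every `a_{ij|K}`. The remaining chart of `a_{ij|∅}` is covered by those of the
`p_I`, because of the quadric `p_∅ p_{ij} - p_i p_j + a_{ij}^2`. -/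

namespace GaussoidQuadrics

open MvPolynomial

/-! ### Minors as determinants of full size, and their row expansion. -/

section Determinants

variable {n : ℕ} {R : Type*} [CommRing R]

/-- The matrix whose rows are the rows of `M` for indices in `K` and standard basis vectors
elsewhere. -/
def rowSelect (M : Matrix (Fin n) (Fin n) R) (K : Finset (Fin n)) : Matrix (Fin n) (Fin n) R :=
  Matrix.of fun l => if l ∈ K then M l else Pi.single l 1

/-- The minor of `M` with rows `j, K` and columns `i, K`, as a determinant of full size. -/
def pairMinor (M : Matrix (Fin n) (Fin n) R) (i j : Fin n) (K : Finset (Fin n)) : R :=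
  ((rowSelect M K).updateRow i (M j)).det

theorem rowSelect_of_mem (M : Matrix (Fin n) (Fin n) R) {K : Finset (Fin n)} {l : Fin n}
    (h : l ∈ K) : rowSelect M K l = M l := by
  exact if_pos h

theorem rowSelect_of_notMem (M : Matrix (Fin n) (Fin n) R) {K : Finset (Fin n)} {l : Fin n}
    (h : l ∉ K) : rowSelect M K l = Pi.single l 1 := by
  exact if_neg h

/-- Unit rows outside `I` make the matrix block triangular with an identity block. Minors of all
sizes thus become `n × n` determinants, to which multiplicativity applies. -/
theorem det_eq_det_toSquareBlockProp (A : Matrix (Fin n) (Fin n) R) (I : Finset (Fin n))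
    (hA : ∀ l ∉ I, A l = Pi.single l 1) :
    A.det = (A.toSquareBlockProp (· ∈ I)).det := by
  rw [Matrix.twoBlockTriangular_det A (· ∈ I)]
  · have : A.toSquareBlockProp (fun i => ¬ i ∈ I) = 1 := by
      ext a b
      simp only [Matrix.toSquareBlockProp_def, Matrix.of_apply, hA _ a.2, Pi.single_apply,
        Matrix.one_apply, Subtype.ext_iff, eq_comm]
    rw [this, Matrix.det_one, mul_one]
    congr!
  · intro i hi j hj
    rw [hA i hi, Pi.single_apply, if_neg]
    rintro rfl
    exact hi hj

theorem det_rowSelect_empty {R : Type*} [CommRing R] (M : Matrix (Fin n) (Fin n) R) :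
    (rowSelect M ∅).det = 1 := by
  have h1 : rowSelect M ∅ = 1 := by
    funext l
    rw [rowSelect_of_notMem M (Finset.notMem_empty l)]
    funext c
    exact (Matrix.one_eq_pi_single).symm
  rw [h1, Matrix.det_one]

theorem principalMinor_eq_det (M : Matrix (Fin n) (Fin n) R) (I : Finset (Fin n)) :
    principalMinor M I = (rowSelect M I).det := by
  rw [det_eq_det_toSquareBlockProp _ I fun l hl => rowSelect_of_notMem M hl, principalMinor]
  congr 1
  ext a b
  change M a b = rowSelect M I a b
  rw [rowSelect_of_mem M a.2]

/-- The type of elements of `insert i K` is obtained from `K` by adding the element `i`. -/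
def optionEquivInsert {i : Fin n} {K : Finset (Fin n)} (h : i ∉ K) :
    Option K ≃ {l // l ∈ insert i K} where
  toFun o := o.elim ⟨i, Finset.mem_insert_self i K⟩ fun l => ⟨l, Finset.mem_insert_of_mem l.2⟩
  invFun l := if hl : (l : Fin n) ∈ K then some ⟨l, hl⟩ else none
  left_inv o := by
    cases o with
    | none => simp [h]
    | some l => simp
  right_inv l := by
    by_cases hl : (l : Fin n) ∈ K
    · simp [hl]
    · beta_reduce
      rw [dif_neg hl]
      exact Subtype.ext ((Finset.mem_insert.1 l.2).resolve_right hl).symm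

theorem almostPrincipalMinor_eq_pairMinor (M : Matrix (Fin n) (Fin n) R) {i : Fin n} (j : Fin n)
    {K : Finset (Fin n)} (hi : i ∉ K) : almostPrincipalMinor M j i K = pairMinor M i j K := by
  rw [pairMinor, det_eq_det_toSquareBlockProp _ (insert i K), almostPrincipalMinor,
    ← Matrix.det_submatrix_equiv_self (optionEquivInsert hi)]
  · congr 1
    ext a b
    have hb : ((optionEquivInsert hi b : {l // l ∈ insert i K}) : Fin n)
        = b.elim i (fun l => (l : Fin n)) := by
      cases b <;> rfl
    simp only [Matrix.submatrix_apply, Matrix.toSquareBlockProp_def, Matrix.of_apply, hb]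
    cases a with
    | none => simp [optionEquivInsert]
    | some a =>
      have : (a : Fin n) ≠ i := fun h => hi (h ▸ a.2)
      simp [optionEquivInsert, Matrix.updateRow_ne this, rowSelect_of_mem M a.2]
  · intro l hl
    rw [Finset.mem_insert, not_or] at hl
    rw [Matrix.updateRow_ne hl.1, rowSelect_of_notMem M hl.2]

theorem almostPrincipalMinor_comm {M : Matrix (Fin n) (Fin n) R} (hM : M.IsSymm) (i j : Fin n)
    (K : Finset (Fin n)) : almostPrincipalMinor M i j K = almostPrincipalMinor M j i K := by
  rw [almostPrincipalMinor, ← Matrix.det_transpose, Matrix.transpose_submatrix, hM.eq]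
  rfl

theorem pairMinor_comm {M : Matrix (Fin n) (Fin n) R} (hM : M.IsSymm) {i j : Fin n}
    {K : Finset (Fin n)} (hi : i ∉ K) (hj : j ∉ K) : pairMinor M i j K = pairMinor M j i K := by
  rw [← almostPrincipalMinor_eq_pairMinor M j hi, ← almostPrincipalMinor_eq_pairMinor M i hj,
    almostPrincipalMinor_comm hM]

theorem rowSelect_insert (M : Matrix (Fin n) (Fin n) R) (i : Fin n) (K : Finset (Fin n)) :
    rowSelect M (insert i K) = (rowSelect M K).updateRow i (M i) := by
  funext l
  by_cases h : l = i
  · subst h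
    rw [Matrix.updateRow_self, rowSelect_of_mem M (Finset.mem_insert_self l K)]
  · rw [Matrix.updateRow_ne h]
    by_cases hl : l ∈ K
    · rw [rowSelect_of_mem M hl, rowSelect_of_mem M (Finset.mem_insert_of_mem hl)]
    · rw [rowSelect_of_notMem M hl, rowSelect_of_notMem M (by simp [h, hl])]

theorem rowSelect_erase (M : Matrix (Fin n) (Fin n) R) (i : Fin n) (K : Finset (Fin n)) :
    rowSelect M (K.erase i) = (rowSelect M K).updateRow i (Pi.single i 1) := by
  funext l
  by_cases h : l = i
  · subst h
    rw [Matrix.updateRow_self, rowSelect_of_notMem M (Finset.notMem_erase l K)]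
  · rw [Matrix.updateRow_ne h]
    by_cases hl : l ∈ K
    · rw [rowSelect_of_mem M hl, rowSelect_of_mem M (Finset.mem_erase.2 ⟨h, hl⟩)]
    · rw [rowSelect_of_notMem M hl, rowSelect_of_notMem M (by simp [hl])]

theorem pairMinor_self (M : Matrix (Fin n) (Fin n) R) (i : Fin n) (K : Finset (Fin n)) :
    pairMinor M i i K = (rowSelect M (insert i K)).det := by
  rw [rowSelect_insert, pairMinor]

theorem det_updateRow_updateRow_swap (A : Matrix (Fin n) (Fin n) R) {i j : Fin n} (h : i ≠ j)
    (u v : Fin n → R) :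
    ((A.updateRow i u).updateRow j v).det = -((A.updateRow i v).updateRow j u).det := by
  have := Matrix.det_permute (Equiv.swap i j) ((A.updateRow i u).updateRow j v)
  rw [Equiv.Perm.sign_swap h] at this
  have e : ((A.updateRow i u).updateRow j v).submatrix (Equiv.swap i j) id
      = (A.updateRow i v).updateRow j u := by
    funext l
    change ((A.updateRow i u).updateRow j v) (Equiv.swap i j l) = _
    by_cases hj : l = j
    · subst hj
      rw [Equiv.swap_apply_right, Matrix.updateRow_ne h, Matrix.updateRow_self,
        Matrix.updateRow_self]
    · by_cases hi : l = i
      · subst hi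
        rw [Equiv.swap_apply_left, Matrix.updateRow_self, Matrix.updateRow_ne h,
          Matrix.updateRow_self]
      · rw [Equiv.swap_apply_of_ne_of_ne hi hj, Matrix.updateRow_ne hj, Matrix.updateRow_ne hi,
          Matrix.updateRow_ne hj, Matrix.updateRow_ne hi]
  rw [e] at this
  rw [this]
  simp

theorem det_updateRow_eq_sum (A : Matrix (Fin n) (Fin n) R) (i : Fin n) (v : Fin n → R) :
    (A.updateRow i v).det = ∑ r, v r * (A.updateRow i (Pi.single r 1)).det := by
  have := (Matrix.detRowAlternating (R := R) (n := Fin n)).toMultilinearMap.map_update_sum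
    Finset.univ i (fun r => v r • (Pi.single r 1 : Fin n → R)) A
  rw [← pi_eq_sum_univ'] at this
  refine this.trans (Finset.sum_congr rfl fun r _ => ?_)
  exact (Matrix.detRowAlternating (R := R) (n := Fin n)).toMultilinearMap.map_update_smul A i _ _

/-- Expansion of a minor along its distinguished row. -/
theorem pairMinor_eq_sub_sum (M : Matrix (Fin n) (Fin n) R) {i : Fin n} (j : Fin n)
    {K : Finset (Fin n)} (hi : i ∉ K) :
    pairMinor M i j K =
      M j i * (rowSelect M K).det - ∑ r ∈ K, M j r * pairMinor M i r (K.erase r) := by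
  -- For such `r` the rows `i` and `r` are both the unit vector at `r`.
  have hrest : ∀ r, r ∉ insert i K →
      M j r * ((rowSelect M K).updateRow i (Pi.single r 1)).det = 0 := by
    intro r hr
    rw [Finset.mem_insert, not_or] at hr
    rw [Matrix.det_zero_of_row_eq (Ne.symm hr.1), mul_zero]
    rw [Matrix.updateRow_self, Matrix.updateRow_ne hr.1, rowSelect_of_notMem M hr.2]
  rw [pairMinor, det_updateRow_eq_sum,
    ← Finset.sum_subset (Finset.subset_univ (insert i K)) fun r _ hr => hrest r hr,
    Finset.sum_insert hi, sub_eq_add_neg, ← Finset.sum_neg_distrib]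
  congr 1
  · rw [← rowSelect_of_notMem M hi, Matrix.updateRow_eq_self]
  · refine Finset.sum_congr rfl fun r hr => ?_
    have hir : r ≠ i := fun h => hi (h ▸ hr)
    -- Exchanging the rows `i` and `r` turns the pair (unit vector at `r`, `M r`) into the pair that
    -- defines the smaller minor, at the cost of a sign.
    rw [← mul_neg, pairMinor, rowSelect_erase, det_updateRow_updateRow_swap _ hir, neg_neg,
      ← rowSelect_of_mem M hr, Matrix.updateRow_eq_self]

end Determinants

/-! ### The principal pivot transform and its effect on minors. -/

section Pivot

variable {n : ℕ} {F : Type*} [Field F]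

/-- The symplectic principal pivot transform of `M` at the diagonal entry `k`. -/
def pivotMatrix (M : Matrix (Fin n) (Fin n) F) (k : Fin n) : Matrix (Fin n) (Fin n) F :=
  Matrix.of fun i j =>
    -- Row and column `k` get equal signs, unlike in the ordinary pivot, so that symmetry survives;
    -- the price is a sign on minors whose index set contains `k`.
    if i = k then (if j = k then -(M k k)⁻¹ else M k j / M k k)
    else if j = k then M i k / M k k else M i j - M i k * M k j / M k k

theorem pivotMatrix_isSymm {M : Matrix (Fin n) (Fin n) F} (hM : M.IsSymm) (k : Fin n) :
    (pivotMatrix M k).IsSymm := by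
  ext i j
  have h := hM.apply
  simp only [Matrix.transpose_apply, pivotMatrix, Matrix.of_apply]
  split_ifs <;> simp_all [mul_comm]

theorem vecMul_rowSelect_singleton (M : Matrix (Fin n) (Fin n) F) (k : Fin n) (v : Fin n → F)
    (c : Fin n) :
    Matrix.vecMul v (rowSelect M {k}) c = v k * M k c + (if c = k then 0 else v c) := by
  rw [Matrix.vecMul, dotProduct, ← Finset.add_sum_erase _ _ (Finset.mem_univ k),
    rowSelect_of_mem M (Finset.mem_singleton_self k)]
  congr 1
  have : ∀ r ∈ Finset.univ.erase k, v r * rowSelect M {k} r c = if r = c then v c else 0 := by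
    intro r hr
    rw [rowSelect_of_notMem M (by simpa using hr), Pi.single_apply]
    by_cases h : r = c
    · subst h; simp
    · simp [h, Ne.symm h]
  rw [Finset.sum_congr rfl this]
  by_cases h : c = k <;> simp [h]

/-- Together with `pivotMatrix_vecMul_self` this determines the transform: right multiplication by
`rowSelect M {k}` undoes it row by row, exchanging the roles of `M k` and the unit vector at `k`. -/
theorem pivotMatrix_vecMul_of_ne {M : Matrix (Fin n) (Fin n) F} {k l : Fin n} (hs : M k k ≠ 0)
    (h : l ≠ k) : Matrix.vecMul (pivotMatrix M k l) (rowSelect M {k}) = M l := by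
  funext c
  rw [vecMul_rowSelect_singleton]
  by_cases hc : c = k
  · subst hc
    simp [pivotMatrix, h, hs]
  · simp only [pivotMatrix, Matrix.of_apply, h, hc, if_false, if_true]
    ring

theorem pivotMatrix_vecMul_self {M : Matrix (Fin n) (Fin n) F} {k : Fin n} (hs : M k k ≠ 0) :
    Matrix.vecMul (pivotMatrix M k k) (rowSelect M {k}) = (-1 : F) • Pi.single k 1 := by
  funext c
  rw [vecMul_rowSelect_singleton]
  by_cases hc : c = k
  · subst hc
    simp [pivotMatrix, hs]
  · simp only [pivotMatrix, Matrix.of_apply, hc, if_false, if_true, Pi.smul_apply,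
      Pi.single_apply, smul_zero]
    ring

theorem rowSelect_mul_apply (M P : Matrix (Fin n) (Fin n) F) (k l : Fin n)
    (I : Finset (Fin n)) :
    (rowSelect P I * rowSelect M {k}) l =
      if l ∈ I then Matrix.vecMul (P l) (rowSelect M {k}) else rowSelect M {k} l := by
  rw [Matrix.mul_apply_eq_vecMul]
  split_ifs with h
  · rw [rowSelect_of_mem P h]
  · rw [rowSelect_of_notMem P h, Matrix.single_one_vecMul]
    rfl

theorem rowSelect_pivotMatrix_mul_of_notMem {M : Matrix (Fin n) (Fin n) F} {k : Fin n}
    (hs : M k k ≠ 0) {I : Finset (Fin n)} (h : k ∉ I) :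
    rowSelect (pivotMatrix M k) I * rowSelect M {k} = rowSelect M (insert k I) := by
  funext l
  rw [rowSelect_mul_apply]
  split_ifs with hl
  · rw [pivotMatrix_vecMul_of_ne hs (fun e => h (e ▸ hl)),
      rowSelect_of_mem M (Finset.mem_insert_of_mem hl)]
  · by_cases hk : l = k
    · subst hk
      rw [rowSelect_of_mem M (Finset.mem_singleton_self l),
        rowSelect_of_mem M (Finset.mem_insert_self l I)]
    · rw [rowSelect_of_notMem M (by simpa using hk), rowSelect_of_notMem M (by simp [hk, hl])]

theorem rowSelect_pivotMatrix_mul_of_mem {M : Matrix (Fin n) (Fin n) F} {k : Fin n}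
    (hs : M k k ≠ 0) {I : Finset (Fin n)} (h : k ∈ I) :
    rowSelect (pivotMatrix M k) I * rowSelect M {k} =
      (rowSelect M I).updateRow k ((-1 : F) • Pi.single k 1) := by
  funext l
  rw [rowSelect_mul_apply]
  by_cases hk : l = k
  · subst hk
    rw [if_pos h, pivotMatrix_vecMul_self hs, Matrix.updateRow_self]
  · rw [Matrix.updateRow_ne hk]
    split_ifs with hl
    · rw [pivotMatrix_vecMul_of_ne hs hk, rowSelect_of_mem M hl]
    · rw [rowSelect_of_notMem M (by simpa using hk), rowSelect_of_notMem M hl]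

theorem det_rowSelect_singleton (M : Matrix (Fin n) (Fin n) F) (k : Fin n) :
    (rowSelect M {k}).det = M k k := by
  have := pairMinor_eq_sub_sum M k (Finset.notMem_empty k)
  rw [pairMinor_self, Finset.sum_empty, sub_zero] at this
  rwa [insert_empty_eq, det_rowSelect_empty, mul_one] at this

/-- The factor `M k k` is the determinant of `rowSelect M {k}`, so this is the determinant of the
matrix products above. -/
theorem mul_det_rowSelect_pivotMatrix {M : Matrix (Fin n) (Fin n) F} {k : Fin n}
    (hs : M k k ≠ 0) (I : Finset (Fin n)) :
    M k k * (rowSelect (pivotMatrix M k) I).det =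
      if k ∈ I then -(rowSelect M (I.erase k)).det else (rowSelect M (insert k I)).det := by
  rw [mul_comm, ← det_rowSelect_singleton M k, ← Matrix.det_mul]
  split_ifs with h
  · rw [rowSelect_pivotMatrix_mul_of_mem hs h, Matrix.det_updateRow_smul, ← rowSelect_erase]
    simp
  · rw [rowSelect_pivotMatrix_mul_of_notMem hs h]

theorem mul_pairMinor_pivotMatrix {M : Matrix (Fin n) (Fin n) F} (hM : M.IsSymm) {k : Fin n}
    (hs : M k k ≠ 0) {i j : Fin n} (hij : i ≠ j) {K : Finset (Fin n)} (hi : i ∉ K) (hj : j ∉ K) :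
    M k k * pairMinor (pivotMatrix M k) i j K =
      if k = i ∨ k = j then pairMinor M i j K
      else if k ∈ K then -pairMinor M i j (K.erase k) else pairMinor M i j (insert k K) := by
  -- The row calculation handles `k` as the first index; symmetry of both matrices gives the case of
  -- the second index.
  have left : ∀ j, j ≠ k → k ∉ K →
      M k k * pairMinor (pivotMatrix M k) k j K = pairMinor M k j K := by
    intro j hj hk
    rw [mul_comm, pairMinor]
    conv_lhs => rw [← det_rowSelect_singleton M k]
    rw [← Matrix.det_mul, Matrix.updateRow_mul, rowSelect_pivotMatrix_mul_of_notMem hs hk,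
      pivotMatrix_vecMul_of_ne hs hj, rowSelect_insert, Matrix.updateRow_idem, pairMinor]
  split_ifs with h hK
  · rcases h with rfl | rfl
    · exact left j hij.symm hi
    · rw [pairMinor_comm (pivotMatrix_isSymm hM k) hi hj, pairMinor_comm hM hi hj]
      exact left i hij hj
  · rw [not_or] at h
    rw [mul_comm, pairMinor, ← det_rowSelect_singleton M k, ← Matrix.det_mul,
      Matrix.updateRow_mul, rowSelect_pivotMatrix_mul_of_mem hs hK,
      pivotMatrix_vecMul_of_ne hs (Ne.symm h.2), Matrix.updateRow_comm _ h.1,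
      Matrix.det_updateRow_smul, Matrix.updateRow_comm _ (Ne.symm h.1), ← rowSelect_erase,
      pairMinor]
    simp
  · rw [not_or] at h
    rw [mul_comm, pairMinor, ← det_rowSelect_singleton M k, ← Matrix.det_mul,
      Matrix.updateRow_mul, rowSelect_pivotMatrix_mul_of_notMem hs hK,
      pivotMatrix_vecMul_of_ne hs (Ne.symm h.2), pairMinor]

end Pivot

/-! ### Unknowns with unordered indices, and their images as minors. -/

section Unknowns

variable {n : ℕ}

/-- The unknown `a_{ij|K}` for distinct `i`, `j`, in either order, and `p_{i ∪ K}` for `i = j`. -/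
noncomputable def pairVar (i j : Fin n) (K : Finset (Fin n)) : MinorRing n :=
  if i = j then X (Sum.inl (insert i K))
  else if h : i < j ∧ i ∉ K ∧ j ∉ K then X (Sum.inr ⟨(i, j, K), h⟩)
  else if h : j < i ∧ j ∉ K ∧ i ∉ K then X (Sum.inr ⟨(j, i, K), h⟩)
  -- Default value: for `i ≠ j` there is no unknown if `K` contains `i` or `j`.
  else 0

theorem pairVar_self (i : Fin n) (K : Finset (Fin n)) :
    pairVar i i K = X (Sum.inl (insert i K)) := if_pos rfl

theorem pairVar_of_lt {i j : Fin n} {K : Finset (Fin n)} (h : i < j ∧ i ∉ K ∧ j ∉ K) :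
    pairVar i j K = X (Sum.inr ⟨(i, j, K), h⟩) := by
  rw [pairVar, if_neg h.1.ne, dif_pos h]

theorem pairVar_comm (i j : Fin n) (K : Finset (Fin n)) : pairVar i j K = pairVar j i K := by
  rcases lt_trichotomy i j with h | rfl | h
  · simp [pairVar, h, h.ne, h.ne', h.not_gt]
  · rfl
  · simp [pairVar, h, h.ne, h.ne', h.not_gt]

theorem X_inr_eq_pairVar (t : AlmostPrincipalIndex n) :
    (X (Sum.inr t) : MinorRing n) = pairVar t.1.1 t.1.2.1 t.1.2.2 :=
  (pairVar_of_lt t.2).symm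

theorem isHomogeneous_pairVar (i j : Fin n) (K : Finset (Fin n)) :
    (pairVar i j K).IsHomogeneous 1 := by
  rw [pairVar]
  split_ifs
  exacts [isHomogeneous_X _ _, isHomogeneous_X _ _, isHomogeneous_X _ _, isHomogeneous_zero _ _ _]

theorem genericSymm_isSymm (n : ℕ) : (genericSymm n).IsSymm := by
  ext i j
  simp [genericSymm, Sym2.eq_swap]

theorem minorMap_X_inl (I : Finset (Fin n)) :
    minorMap n (X (Sum.inl I)) = (rowSelect (genericSymm n) I).det := by
  rw [minorMap, aeval_X, Sum.elim_inl, principalMinor_eq_det]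

theorem minorMap_pairVar {i j : Fin n} {K : Finset (Fin n)} (hi : i ∉ K) (hj : j ∉ K) :
    minorMap n (pairVar i j K) = pairMinor (genericSymm n) i j K := by
  have key : ∀ i j : Fin n, i < j → i ∉ K → j ∉ K →
      minorMap n (pairVar i j K) = pairMinor (genericSymm n) i j K := by
    intro i j h hi hj
    rw [pairVar_of_lt ⟨h, hi, hj⟩, minorMap, aeval_X, Sum.elim_inr,
      almostPrincipalMinor_eq_pairMinor _ _ hj, pairMinor_comm (genericSymm_isSymm n) hj hi]
  rcases lt_trichotomy i j with h | rfl | h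
  · exact key i j h hi hj
  · rw [pairVar_self, minorMap_X_inl, pairMinor_self]
  · rw [pairVar_comm, key j i h hj hi, pairMinor_comm (genericSymm_isSymm n) hj hi]

theorem map_rowSelect {R T : Type*} [CommRing R] [CommRing T] (g : R →+* T)
    (M : Matrix (Fin n) (Fin n) R) (K : Finset (Fin n)) :
    (rowSelect M K).map g = rowSelect (M.map g) K := by
  ext l c
  rw [Matrix.map_apply]
  by_cases h : l ∈ K
  · rw [rowSelect_of_mem M h, rowSelect_of_mem _ h, Matrix.map_apply]
  · rw [rowSelect_of_notMem M h, rowSelect_of_notMem _ h, Pi.single_apply, Pi.single_apply]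
    split_ifs <;> simp

theorem map_det_rowSelect {R T : Type*} [CommRing R] [CommRing T] (g : R →+* T)
    (M : Matrix (Fin n) (Fin n) R) (K : Finset (Fin n)) :
    g (rowSelect M K).det = (rowSelect (M.map g) K).det := by
  rw [RingHom.map_det, RingHom.mapMatrix_apply, map_rowSelect]

theorem map_pairMinor {R T : Type*} [CommRing R] [CommRing T] (g : R →+* T)
    (M : Matrix (Fin n) (Fin n) R) (i j : Fin n) (K : Finset (Fin n)) :
    g (pairMinor M i j K) = pairMinor (M.map g) i j K := by
  rw [pairMinor, RingHom.map_det, RingHom.mapMatrix_apply, Matrix.map_updateRow, map_rowSelect]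
  rfl

/-- A homogeneous polynomial is evaluated at a scaled point by scaling its value. -/
theorem aeval_eq_pow_mul_of_isHomogeneous {σ A : Type*} [CommRing A] [Algebra ℝ A]
    {f : MvPolynomial σ ℝ} {d : ℕ} (hf : f.IsHomogeneous d) {g h : σ → A} {s : A}
    (hgh : ∀ v, h v = s * g v) : aeval h f = s ^ d * aeval g f := by
  rw [aeval_def, aeval_def, eval₂_eq, eval₂_eq, Finset.mul_sum]
  refine Finset.sum_congr rfl fun m hm => ?_
  have hd : ∑ i ∈ m.support, m i = d := by
    have := hf (mem_support_iff.1 hm)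
    simpa [Finsupp.weight_apply, Finsupp.sum] using this
  simp_rw [hgh, mul_pow, Finset.prod_mul_distrib, Finset.prod_pow_eq_pow_sum, hd]
  ring

end Unknowns

/-! ### The pivot action on the polynomial ring. -/

section PivotAction

variable {n : ℕ}

/-- The action on the unknowns of the pivot transform at `k`. -/
noncomputable def pivotVar (k : Fin n) : MinorIndex n → MinorRing n :=
  Sum.elim
    (fun I => if k ∈ I then -X (Sum.inl (I.erase k)) else X (Sum.inl (insert k I)))
    (fun t => if k = t.1.1 ∨ k = t.1.2.1 then X (Sum.inr t)
      else if k ∈ t.1.2.2 then -pairVar t.1.1 t.1.2.1 (t.1.2.2.erase k)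
      else pairVar t.1.1 t.1.2.1 (insert k t.1.2.2))

/-- The endomorphism of the ring of unknowns given by the pivot transform at `k`. -/
noncomputable def pivotHom (k : Fin n) : MinorRing n →ₐ[ℝ] MinorRing n := aeval (pivotVar k)

theorem pivotHom_X_inl_of_mem {k : Fin n} {I : Finset (Fin n)} (h : k ∈ I) :
    pivotHom k (X (Sum.inl I)) = -X (Sum.inl (I.erase k)) := by
  rw [pivotHom, aeval_X, pivotVar, Sum.elim_inl, if_pos h]

theorem pivotHom_X_inl_of_notMem {k : Fin n} {I : Finset (Fin n)} (h : k ∉ I) :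
    pivotHom k (X (Sum.inl I)) = X (Sum.inl (insert k I)) := by
  rw [pivotHom, aeval_X, pivotVar, Sum.elim_inl, if_neg h]

theorem pivotHom_pairVar (k : Fin n) {i j : Fin n} (hij : i ≠ j) {K : Finset (Fin n)}
    (hi : i ∉ K) (hj : j ∉ K) :
    pivotHom k (pairVar i j K) = if k = i ∨ k = j then pairVar i j K
      else if k ∈ K then -pairVar i j (K.erase k) else pairVar i j (insert k K) := by
  have key : ∀ i j : Fin n, i < j → i ∉ K → j ∉ K →
      pivotHom k (pairVar i j K) = if k = i ∨ k = j then pairVar i j K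
        else if k ∈ K then -pairVar i j (K.erase k) else pairVar i j (insert k K) := by
    intro i j h hi hj
    rw [pairVar_of_lt ⟨h, hi, hj⟩, pivotHom, aeval_X, pivotVar, Sum.elim_inr]
  rcases lt_or_gt_of_ne hij with h | h
  · exact key i j h hi hj
  · rw [pairVar_comm i j, key j i h hj hi, pairVar_comm i j, pairVar_comm i j]
    simp only [or_comm]

theorem isHomogeneous_pivotVar (k : Fin n) (v : MinorIndex n) :
    (pivotVar k v).IsHomogeneous 1 := by
  rcases v with I | t
  · rw [pivotVar, Sum.elim_inl]
    split_ifs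
    exacts [(isHomogeneous_X _ _).neg, isHomogeneous_X _ _]
  · rw [pivotVar, Sum.elim_inr]
    split_ifs
    exacts [isHomogeneous_X _ _, (isHomogeneous_pairVar _ _ _).neg, isHomogeneous_pairVar _ _ _]

theorem isHomogeneous_pivotHom (k : Fin n) {f : MinorRing n} {d : ℕ} (hf : f.IsHomogeneous d) :
    (pivotHom k f).IsHomogeneous d := by
  have := hf.aeval (pivotVar k) (isHomogeneous_pivotVar k)
  rwa [one_mul] at this

theorem pivotHom_pivotHom_X (k : Fin n) (v : MinorIndex n) :
    pivotHom k (pivotHom k (X v)) = X v ∨ pivotHom k (pivotHom k (X v)) = -X v := by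
  rcases v with I | t
  · right
    by_cases h : k ∈ I
    · rw [pivotHom_X_inl_of_mem h, map_neg, pivotHom_X_inl_of_notMem (Finset.notMem_erase k I),
        Finset.insert_erase h]
    · rw [pivotHom_X_inl_of_notMem h, pivotHom_X_inl_of_mem (Finset.mem_insert_self k I),
        Finset.erase_insert h]
  · obtain ⟨⟨i, j, K⟩, hij, hi, hj⟩ := t
    simp only at hij hi hj
    rw [X_inr_eq_pairVar]
    simp only
    by_cases h : k = i ∨ k = j
    · left
      rw [pivotHom_pairVar k hij.ne hi hj, if_pos h, pivotHom_pairVar k hij.ne hi hj, if_pos h]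
    · right
      have h' := not_or.1 h
      rw [pivotHom_pairVar k hij.ne hi hj, if_neg h]
      by_cases hK : k ∈ K
      · rw [if_pos hK, map_neg, pivotHom_pairVar k hij.ne (by simp [hi]) (by simp [hj]), if_neg h,
          if_neg (Finset.notMem_erase k K), Finset.insert_erase hK]
      · rw [if_neg hK, pivotHom_pairVar k hij.ne (by simp [hi, Ne.symm h'.1])
          (by simp [hj, Ne.symm h'.2]), if_neg h, if_pos (Finset.mem_insert_self k K),
          Finset.erase_insert hK]

/-- The square of the pivot is only a sign change on each unknown, so the fourth power is the
identity and the cube is an inverse. -/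
theorem pivotHom_iterate_four (k : Fin n) (f : MinorRing n) :
    pivotHom k (pivotHom k (pivotHom k (pivotHom k f))) = f := by
  have : ((pivotHom k).comp ((pivotHom k).comp ((pivotHom k).comp (pivotHom k)))) =
      AlgHom.id ℝ (MinorRing n) := by
    ext1 v
    simp only [AlgHom.comp_apply, AlgHom.id_apply]
    rcases pivotHom_pivotHom_X k v with h | h <;> rw [h]
    · exact h
    · rw [map_neg, map_neg, h, neg_neg]
  exact DFunLike.congr_fun this f

/-- The pivot transform preserves the homogeneous polynomials in the kernel of `minorMap`. -/
theorem minorMap_pivotHom_eq_zero (k : Fin n) {f : MinorRing n} {d : ℕ} (hf : f.IsHomogeneous d)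
    (h0 : minorMap n f = 0) : minorMap n (pivotHom k f) = 0 := by
  -- Pivoting the generic matrix divides by `σ_kk`, hence the fraction field; `ρ` below substitutes
  -- the pivoted matrix for the generic one.
  let F := FractionRing (MvPolynomial (Sym2 (Fin n)) ℝ)
  let ι : MvPolynomial (Sym2 (Fin n)) ℝ →ₐ[ℝ] F := Algebra.algHom ℝ _ F
  have hι : Function.Injective ι := IsFractionRing.injective (MvPolynomial (Sym2 (Fin n)) ℝ) F
  let M : Matrix (Fin n) (Fin n) F := (genericSymm n).map ι
  have hM : M.IsSymm := (genericSymm_isSymm n).map ι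
  have hs : M k k ≠ 0 := by
    change ι (X s(k, k)) ≠ 0
    rw [map_ne_zero_iff ι hι]
    exact X_ne_zero _
  let ρ : MvPolynomial (Sym2 (Fin n)) ℝ →ₐ[ℝ] F :=
    aeval (Sym2.lift ⟨fun i j => pivotMatrix M k i j,
      fun i j => (pivotMatrix_isSymm hM k).apply j i⟩)
  have hρ : (genericSymm n).map ρ = pivotMatrix M k := by
    ext i j
    simp [genericSymm, ρ]
  -- The factor `σ_kk` is the same for all unknowns, so on forms of degree `d` it comes out as `σ_kk
  -- ^ d`.
  have key : ∀ v, ι (minorMap n (pivotVar k v)) = M k k * ρ (minorMap n (X v)) := by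
    rintro (I | t)
    · have := mul_det_rowSelect_pivotMatrix hs I
      rw [← hρ] at this
      rw [minorMap_X_inl]
      refine Eq.trans ?_ (this.symm.trans (congrArg _ (map_det_rowSelect ρ.toRingHom _ I).symm))
      rw [pivotVar, Sum.elim_inl]
      split_ifs
      · rw [map_neg, map_neg, minorMap_X_inl]
        exact congrArg _ (map_det_rowSelect ι.toRingHom _ _)
      · rw [minorMap_X_inl]
        exact map_det_rowSelect ι.toRingHom _ _
    · obtain ⟨⟨i, j, K⟩, hij, hi, hj⟩ := t
      simp only at hij hi hj
      have := mul_pairMinor_pivotMatrix hM hs hij.ne hi hj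
      rw [← hρ] at this
      rw [X_inr_eq_pairVar]
      simp only
      rw [minorMap_pairVar hi hj]
      refine Eq.trans ?_ (this.symm.trans (congrArg _ (map_pairMinor ρ.toRingHom _ i j K).symm))
      rw [pivotVar, Sum.elim_inr]
      simp only
      split_ifs with h hK
      · rw [X_inr_eq_pairVar]
        simp only
        rw [minorMap_pairVar hi hj]
        exact map_pairMinor ι.toRingHom _ _ _ _
      · rw [map_neg, map_neg, minorMap_pairVar (by simp [hi]) (by simp [hj])]
        exact congrArg _ (map_pairMinor ι.toRingHom _ _ _ _)
      · rw [not_or] at h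
        rw [minorMap_pairVar (by simp [hi, Ne.symm h.1]) (by simp [hj, Ne.symm h.2])]
        exact map_pairMinor ι.toRingHom _ _ _ _
  apply hι
  have e1 : ι (minorMap n (pivotHom k f)) = aeval (fun v => ι (minorMap n (pivotVar k v))) f := by
    have : (ι.comp (minorMap n)).comp (pivotHom k) =
        aeval (fun v => ι (minorMap n (pivotVar k v))) := by
      ext1 v
      simp [pivotHom]
    exact DFunLike.congr_fun this f
  have e2 : aeval (fun v => ρ (minorMap n (X v))) f = ρ (minorMap n f) := by
    have : aeval (fun v => ρ (minorMap n (X v))) = ρ.comp (minorMap n) := by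
      ext1 v
      simp
    exact DFunLike.congr_fun this f
  rw [e1, aeval_eq_pow_mul_of_isHomogeneous hf key, e2, h0, map_zero, mul_zero, map_zero]

end PivotAction

/-! ### Saturation of the quadric ideal with respect to each unknown. -/

section Charts

variable {n : ℕ}

theorem minorMap_eq_zero_of_mem_J {f : MinorRing n} (hf : f ∈ (J n).toIdeal) :
    minorMap n f = 0 := by
  have : (J n).toIdeal ≤ RingHom.ker (minorMap n) := Ideal.span_le.2 fun g hg => hg.2
  exact this hf

theorem mem_J_of_isHomogeneous {f : MinorRing n} {d : ℕ} (hd : f.IsHomogeneous d)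
    (h0 : minorMap n f = 0) : f ∈ (J n).toIdeal :=
  Ideal.subset_span ⟨⟨d, hd⟩, h0⟩

theorem mem_quadricIdeal_of_isHomogeneous {f : MinorRing n} (hd : f.IsHomogeneous 2)
    (h0 : minorMap n f = 0) : f ∈ (quadricIdeal n).toIdeal :=
  Ideal.subset_span ⟨hd, mem_J_of_isHomogeneous hd h0⟩

theorem quadricIdeal_le_J (n : ℕ) : (quadricIdeal n).toIdeal ≤ (J n).toIdeal :=
  Ideal.span_le.2 fun _ hg => hg.2

theorem pivotHom_mem_quadricIdeal (k : Fin n) {f : MinorRing n}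
    (hf : f ∈ (quadricIdeal n).toIdeal) : pivotHom k f ∈ (quadricIdeal n).toIdeal := by
  have : (quadricIdeal n).toIdeal ≤ (quadricIdeal n).toIdeal.comap (pivotHom k) :=
    Ideal.span_le.2 fun g hg => mem_quadricIdeal_of_isHomogeneous (isHomogeneous_pivotHom k hg.1)
      (minorMap_pivotHom_eq_zero k hg.1 (minorMap_eq_zero_of_mem_J hg.2))
  exact this hf

theorem minorMap_X_empty (n : ℕ) : minorMap n (X (Sum.inl ∅)) = 1 := by
  rw [minorMap_X_inl, det_rowSelect_empty]

theorem minorMap_pairVar_empty (i j : Fin n) :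
    minorMap n (pairVar i j ∅) = X s(i, j) := by
  rw [minorMap_pairVar (Finset.notMem_empty i) (Finset.notMem_empty j),
    pairMinor_eq_sub_sum _ _ (Finset.notMem_empty i), det_rowSelect_empty, Finset.sum_empty,
    sub_zero, mul_one, Sym2.eq_swap]
  rfl

/-- Row expansion of a minor becomes homogeneous of degree two once the left side is multiplied by
`p_∅`, which maps to `1`. The case `i = j` is included and expands principal minors. -/
theorem expansion_mem_quadricIdeal {i j : Fin n} {K : Finset (Fin n)} (hi : i ∉ K) (hj : j ∉ K) :
    X (Sum.inl ∅) * pairVar i j K - (pairVar j i ∅ * X (Sum.inl K) -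
      ∑ r ∈ K, pairVar j r ∅ * pairVar i r (K.erase r)) ∈ (quadricIdeal n).toIdeal := by
  apply mem_quadricIdeal_of_isHomogeneous
  · refine ((isHomogeneous_X _ _).mul (isHomogeneous_pairVar _ _ _)).sub
      (((isHomogeneous_pairVar _ _ _).mul (isHomogeneous_X _ _)).sub ?_)
    exact IsHomogeneous.sum _ _ _ fun r _ =>
      (isHomogeneous_pairVar _ _ _).mul (isHomogeneous_pairVar _ _ _)
  · simp only [map_sub, map_mul, map_sum, minorMap_pairVar_empty, minorMap_X_inl,
      minorMap_pairVar hi hj]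
    rw [det_rowSelect_empty, one_mul, pairMinor_eq_sub_sum _ _ hi, sub_eq_zero]
    refine congrArg₂ _ rfl (Finset.sum_congr rfl fun r hr => ?_)
    rw [minorMap_pairVar (by simp [hi]) (Finset.notMem_erase r K)]
    rfl

theorem square_mem_quadricIdeal {i j : Fin n} (hij : i ≠ j) :
    X (Sum.inl ∅) * X (Sum.inl {i, j}) - (X (Sum.inl {i}) * X (Sum.inl {j}) - pairVar i j ∅ ^ 2)
      ∈ (quadricIdeal n).toIdeal := by
  have h := expansion_mem_quadricIdeal (i := i) (j := i) (K := {j}) (by simpa using hij)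
    (by simpa using hij)
  simp only [Finset.sum_singleton, Finset.erase_singleton, pairVar_self, insert_empty_eq] at h
  rwa [← sq] at h

/-- On the chart where `p_∅` does not vanish, the quadrics define the variety. -/
theorem exists_X_empty_pow_mul_mem {f : MinorRing n} {d : ℕ} (hf : f.IsHomogeneous d)
    (h0 : minorMap n f = 0) :
    ∃ N : ℕ, X (Sum.inl ∅) ^ N * f ∈ (quadricIdeal n).toIdeal := by
  let Q := (quadricIdeal n).toIdeal
  let x : MinorRing n ⧸ Q := Ideal.Quotient.mk Q (X (Sum.inl ∅))
  let φ : MinorRing n →ₐ[ℝ] Localization.Away x :=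
    (Algebra.algHom ℝ (MinorRing n ⧸ Q) (Localization.Away x)).comp (Ideal.Quotient.mkₐ ℝ Q)
  have hφ : ∀ g, φ g = algebraMap (MinorRing n ⧸ Q) (Localization.Away x)
    (Ideal.Quotient.mk Q g) := fun g => rfl
  obtain ⟨u, hu⟩ : IsUnit (φ (X (Sum.inl ∅))) := IsLocalization.Away.algebraMap_isUnit x
  -- Dehomogenization: `σ_ij` goes to `a_{ij} / p_∅`, a section of the chart's coordinates.
  let θ : MvPolynomial (Sym2 (Fin n)) ℝ →ₐ[ℝ] Localization.Away x :=
    aeval (Sym2.lift ⟨fun i j => (↑u⁻¹ : Localization.Away x) * φ (pairVar i j ∅),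
      fun i j => by beta_reduce; rw [pairVar_comm]⟩)
  have hθ : ∀ i j, φ (pairVar i j ∅) = u * θ (X s(i, j)) := by
    intro i j
    simp [θ]
  have main : ∀ K : Finset (Fin n),
      φ (X (Sum.inl K)) = u * θ (minorMap n (X (Sum.inl K))) ∧
      ∀ i j, i ∉ K → j ∉ K → φ (pairVar i j K) = u * θ (minorMap n (pairVar i j K)) := by
    intro K
    induction K using Finset.strongInduction with
    | H K ih =>
      -- For `i ∈ K`, `p_K` is the pair unknown with both indices `i` over the smaller set `K.erase
      -- i`.
      have hK : φ (X (Sum.inl K)) = u * θ (minorMap n (X (Sum.inl K))) := by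
        rcases K.eq_empty_or_nonempty with rfl | ⟨i, hi⟩
        · rw [minorMap_X_empty, map_one, mul_one, hu]
        · have := (ih _ (Finset.erase_ssubset hi)).2 i i (Finset.notMem_erase i K)
            (Finset.notMem_erase i K)
          rwa [pairVar_self, Finset.insert_erase hi] at this
      refine ⟨hK, fun i j hi hj => ?_⟩
      have hq := expansion_mem_quadricIdeal hi hj
      have h1 := (hφ _).trans
        ((congrArg _ (Ideal.Quotient.eq_zero_iff_mem.2 hq)).trans (map_zero _))
      have h2 := minorMap_eq_zero_of_mem_J (quadricIdeal_le_J n hq)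
      rw [map_sub, sub_eq_zero] at h1 h2
      simp only [map_sub, map_mul, map_sum, minorMap_X_empty, minorMap_pairVar_empty,
        one_mul] at h1 h2
      rw [← hu] at h1
      apply (Units.isUnit u).mul_left_cancel
      rw [h1, h2, map_sub, map_mul, map_sum, hK, hθ, mul_sub, mul_sub, Finset.mul_sum,
        Finset.mul_sum]
      refine congrArg₂ _ (by ring) (Finset.sum_congr rfl fun r hr => ?_)
      rw [hθ, (ih _ (Finset.erase_ssubset hr)).2 i r (by simp [hi]) (Finset.notMem_erase r K),
        map_mul]
      ring
  have key : ∀ v, φ (X v) = u * θ (minorMap n (X v)) := by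
    rintro (I | t)
    · exact (main I).1
    · rw [X_inr_eq_pairVar]
      exact (main t.1.2.2).2 _ _ t.2.2.1 t.2.2.2
  have e1 : aeval (fun v => φ (X v)) f = φ f := by
    have : aeval (fun v => φ (X v)) = φ := by ext1 v; simp
    exact DFunLike.congr_fun this f
  have e2 : aeval (fun v => θ (minorMap n (X v))) f = θ (minorMap n f) := by
    have : aeval (fun v => θ (minorMap n (X v))) = θ.comp (minorMap n) := by ext1 v; simp
    exact DFunLike.congr_fun this f
  have hf0 : φ f = 0 := by
    rw [← e1, aeval_eq_pow_mul_of_isHomogeneous hf key, e2, h0, map_zero, mul_zero]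
  rw [hφ, IsLocalization.map_eq_zero_iff (Submonoid.powers x)] at hf0
  obtain ⟨⟨_, N, rfl⟩, hN⟩ := hf0
  refine ⟨N, Ideal.Quotient.eq_zero_iff_mem.1 ?_⟩
  rw [map_mul, map_pow]
  exact hN

/-- The property of a polynomial `x` that the quadrics define the variety on the chart where `x`
does not vanish is invariant under the pivot transforms. -/
theorem exists_pow_mul_mem_of_pivotHom (k : Fin n) {x y : MinorRing n}
    (hxy : pivotHom k x = y)
    (hx : ∀ (f : MinorRing n) (d : ℕ), f.IsHomogeneous d → minorMap n f = 0 →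
      ∃ N : ℕ, x ^ N * f ∈ (quadricIdeal n).toIdeal)
    (f : MinorRing n) (d : ℕ) (hf : f.IsHomogeneous d) (h0 : minorMap n f = 0) :
    ∃ N : ℕ, y ^ N * f ∈ (quadricIdeal n).toIdeal := by
  have h1 := isHomogeneous_pivotHom k hf
  have h2 := isHomogeneous_pivotHom k h1
  have z1 := minorMap_pivotHom_eq_zero k hf h0
  have z2 := minorMap_pivotHom_eq_zero k h1 z1
  -- The hypothesis is applied to the inverse image of `f`, which is its third iterate.
  obtain ⟨N, hN⟩ := hx _ d (isHomogeneous_pivotHom k h2) (minorMap_pivotHom_eq_zero k h2 z2)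
  refine ⟨N, ?_⟩
  have := pivotHom_mem_quadricIdeal k hN
  rwa [map_mul, map_pow, pivotHom_iterate_four, hxy] at this

theorem exists_X_inl_pow_mul_mem (I : Finset (Fin n)) :
    ∀ (f : MinorRing n) (d : ℕ), f.IsHomogeneous d → minorMap n f = 0 →
      ∃ N : ℕ, X (Sum.inl I) ^ N * f ∈ (quadricIdeal n).toIdeal := by
  induction I using Finset.induction_on with
  | empty => exact fun f d hf h0 => exists_X_empty_pow_mul_mem hf h0
  | insert k I hk ih => exact exists_pow_mul_mem_of_pivotHom k (pivotHom_X_inl_of_notMem hk) ih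

/-- Pivots at `k ∉ {i, j}` change only `K`, so `K = ∅` needs its own argument: every `p_I` lies in
the radical of the colon ideal of `f`, and `square_mem_quadricIdeal` then puts `a_{ij}` there too.
-/
theorem exists_pairVar_pow_mul_mem {i j : Fin n} (hij : i ≠ j) (K : Finset (Fin n)) :
    i ∉ K → j ∉ K → ∀ (f : MinorRing n) (d : ℕ), f.IsHomogeneous d → minorMap n f = 0 →
      ∃ N : ℕ, pairVar i j K ^ N * f ∈ (quadricIdeal n).toIdeal := by
  induction K using Finset.induction_on with
  | empty =>
    intro _ _ f d hf h0
    let T : Ideal (MinorRing n) := (quadricIdeal n).toIdeal.colon {f}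
    have hT : ∀ g, g ∈ T ↔ g * f ∈ (quadricIdeal n).toIdeal := fun g =>
      Submodule.mem_colon_singleton
    have hrad : ∀ I, X (Sum.inl I) ∈ T.radical := fun I => by
      obtain ⟨N, hN⟩ := exists_X_inl_pow_mul_mem I f d hf h0
      exact ⟨N, (hT _).2 hN⟩
    have hsq : pairVar i j ∅ ^ 2 ∈ T.radical := by
      have hq : X (Sum.inl ∅) * X (Sum.inl {i, j}) -
          (X (Sum.inl {i}) * X (Sum.inl {j}) - pairVar i j ∅ ^ 2) ∈ T.radical :=
        Ideal.le_radical ((hT _).2 (Ideal.mul_mem_right _ _ (square_mem_quadricIdeal hij)))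
      rwa [Submodule.sub_mem_iff_right _ (Ideal.mul_mem_right _ _ (hrad ∅)),
        Submodule.sub_mem_iff_right _ (Ideal.mul_mem_right _ _ (hrad {i}))] at hq
    obtain ⟨N, hN⟩ := (Ideal.radical_isRadical T) ⟨2, hsq⟩
    exact ⟨N, (hT _).1 hN⟩
  | insert k K hk ih =>
    intro hi hj
    rw [Finset.mem_insert, not_or] at hi hj
    refine exists_pow_mul_mem_of_pivotHom k ?_ (ih hi.2 hj.2)
    rw [pivotHom_pairVar k hij hi.2 hj.2, if_neg (not_or.2 ⟨Ne.symm hi.1, Ne.symm hj.1⟩),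
      if_neg hk]

theorem exists_X_pow_mul_mem (v : MinorIndex n) {f : MinorRing n} (hf : f ∈ (J n).toIdeal) :
    ∃ N : ℕ, X v ^ N * f ∈ (quadricIdeal n).toIdeal := by
  have hom : ∀ (f : MinorRing n) (d : ℕ), f.IsHomogeneous d → minorMap n f = 0 →
      ∃ N : ℕ, X v ^ N * f ∈ (quadricIdeal n).toIdeal := by
    rcases v with I | t
    · exact exists_X_inl_pow_mul_mem I
    · rw [X_inr_eq_pairVar]
      exact exists_pairVar_pow_mul_mem t.2.1.ne _ t.2.2.1 t.2.2.2
  refine Submodule.span_induction (p := fun f _ => ∃ N : ℕ, X v ^ N * f ∈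
    (quadricIdeal n).toIdeal) ?_ ⟨0, by simp⟩ ?_ ?_ hf
  · rintro g ⟨⟨d, hd⟩, h0⟩
    exact hom g d hd h0
  · rintro g h _ _ ⟨N, hN⟩ ⟨N', hN'⟩
    refine ⟨N + N', ?_⟩
    have := add_mem (Ideal.mul_mem_left _ (X v ^ N') hN) (Ideal.mul_mem_left _ (X v ^ N) hN')
    convert this using 1
    ring
  · rintro a g _ ⟨N, hN⟩
    refine ⟨N, ?_⟩
    rw [smul_eq_mul, mul_left_comm]
    exact Ideal.mul_mem_left _ _ hN

end Charts

/-! ### From saturation to large degrees and to the ideal sheaf. -/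

section Conclusion

variable {n : ℕ}

theorem mem_idealOfVars_pow_of_isHomogeneous {σ : Type*} {f : MvPolynomial σ ℝ} {d k : ℕ}
    (hf : f.IsHomogeneous d) (h : k ≤ d) : f ∈ idealOfVars σ ℝ ^ k := by
  rw [mem_pow_idealOfVars_iff]
  intro m hm
  have hd := hf (mem_support_iff.1 hm)
  rw [Finsupp.degree_eq_weight_one]
  exact h.trans hd.ge

/-- All unknowns lie in the radical of the colon ideal of `f`; as they are finitely many, one power
of the ideal they generate lies in the colon ideal itself. -/
theorem exists_idealOfVars_pow_mul_mem {f : MinorRing n} (hf : f ∈ (J n).toIdeal) :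
    ∃ k : ℕ, ∀ g ∈ idealOfVars (MinorIndex n) ℝ ^ k, g * f ∈ (quadricIdeal n).toIdeal := by
  have hrad : idealOfVars (MinorIndex n) ℝ ≤ ((quadricIdeal n).toIdeal.colon {f}).radical := by
    rw [idealOfVars, Ideal.span_le]
    rintro _ ⟨v, rfl⟩
    obtain ⟨N, hN⟩ := exists_X_pow_mul_mem v hf
    exact ⟨N, Submodule.mem_colon_singleton.2 hN⟩
  obtain ⟨k, hk⟩ := Ideal.exists_pow_le_of_le_radical_of_fg hrad (idealOfVars_fg _ _)
  exact ⟨k, fun g hg => Submodule.mem_colon_singleton.1 (hk hg)⟩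

theorem exists_degree_bound (n : ℕ) : ∃ D : ℕ, ∀ d : ℕ, D ≤ d → ∀ f : MinorRing n,
    f.IsHomogeneous d → f ∈ (J n).toIdeal → f ∈ (quadricIdeal n).toIdeal := by
  obtain ⟨S, hS, hspan⟩ := (Submodule.fg_span_iff_fg_span_finset_subset _).1
    (IsNoetherian.noetherian (J n).toIdeal)
  have hJ : ∀ g ∈ S, g ∈ (J n).toIdeal := fun g hg => Ideal.subset_span (hS hg)
  have hbound : ∀ g ∈ S, ∃ D : ℕ, ∀ d, D ≤ d → ∀ c : MinorRing n,
      homogeneousComponent d (c * g) ∈ (quadricIdeal n).toIdeal := by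
    intro g hg
    obtain ⟨⟨e, he⟩, -⟩ := hS hg
    obtain ⟨k, hk⟩ := exists_idealOfVars_pow_mul_mem (hJ g hg)
    -- Only the component of `c` of degree `d - e ≥ k` contributes, and it lies in the `k`-th power
    -- of the ideal of the unknowns.
    refine ⟨k + e, fun d hd c => ?_⟩
    rw [← sum_homogeneousComponent c, Finset.sum_mul, map_sum]
    refine sum_mem fun j _ => ?_
    have hj := homogeneousComponent_isHomogeneous j c
    rw [homogeneousComponent_of_mem (hj.mul he)]
    split_ifs with h
    · exact hk _ (mem_idealOfVars_pow_of_isHomogeneous hj (by omega))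
    · exact zero_mem _
  choose! D hD using hbound
  refine ⟨S.sup D, fun d hd f hf hfJ => ?_⟩
  have hf' : f ∈ Submodule.span (MinorRing n) (S : Set (MinorRing n)) := hspan ▸ hfJ
  obtain ⟨c, -, rfl⟩ := Submodule.mem_span_finset.1 hf'
  rw [← homogeneousComponent_eq_self hf, map_sum]
  exact sum_mem fun g hg => hD g hg d ((Finset.le_sup hg).trans hd) (c g)

theorem map_J_eq_map_quadricIdeal (x : ProjectiveSpectrum (grading n)) :
    (J n).toIdeal.map (algebraMap (MinorRing n)
      (Localization.AtPrime x.asHomogeneousIdeal.toIdeal)) =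
    (quadricIdeal n).toIdeal.map (algebraMap (MinorRing n)
      (Localization.AtPrime x.asHomogeneousIdeal.toIdeal)) := by
  -- A point of `Proj` does not contain the irrelevant ideal, so some unknown becomes a unit in the
  -- local ring.
  obtain ⟨v, hv⟩ : ∃ v, X v ∉ x.asHomogeneousIdeal.toIdeal := by
    by_contra! h
    refine x.not_irrelevant_le ((HomogeneousIdeal.toIdeal_irrelevant_le _).2 fun i hi f hf => ?_)
    have := mem_idealOfVars_pow_of_isHomogeneous (k := 1) hf hi
    rw [pow_one] at this
    exact (Ideal.span_le.2 (Set.range_subset_iff.2 h)) this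
  refine le_antisymm (Ideal.map_le_iff_le_comap.2 fun f hf => ?_)
    (Ideal.map_mono (quadricIdeal_le_J n))
  obtain ⟨N, hN⟩ := exists_X_pow_mul_mem v hf
  have hmem := Ideal.mem_map_of_mem (algebraMap (MinorRing n)
    (Localization.AtPrime x.asHomogeneousIdeal.toIdeal)) hN
  rw [map_mul] at hmem
  rw [Ideal.mem_comap]
  refine (Ideal.unit_mul_mem_iff_mem _ ?_).1 hmem
  rw [map_pow]
  exact (IsLocalization.map_units _
    (⟨X v, hv⟩ : x.asHomogeneousIdeal.toIdeal.primeCompl)).pow N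

theorem stalkIdeal_J_eq_stalkIdeal_quadricIdeal (x : ProjectiveSpectrum (grading n)) :
    stalkIdeal (J n) x = stalkIdeal (quadricIdeal n) x :=
  congrArg (Ideal.comap _) (map_J_eq_map_quadricIdeal x)

end Conclusion

end GaussoidQuadrics

theorem mainTheorem5 (n : ℕ) :
    (∀ U : (AlgebraicGeometry.Proj (GaussoidQuadrics.grading n)).Opens,
      GaussoidQuadrics.idealSheaf (GaussoidQuadrics.J n) U =
        GaussoidQuadrics.idealSheaf (GaussoidQuadrics.quadricIdeal n) U) ∧
    ∃ D : ℕ, ∀ d : ℕ, D ≤ d → ∀ f : GaussoidQuadrics.MinorRing n, f.IsHomogeneous d →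
      (f ∈ GaussoidQuadrics.quadricIdeal n ↔ f ∈ GaussoidQuadrics.J n) := by
  refine ⟨fun U => ?_, ?_⟩
  · exact iInf_congr fun x => congrArg (Ideal.comap _)
      (GaussoidQuadrics.stalkIdeal_J_eq_stalkIdeal_quadricIdeal x.1)
  · obtain ⟨D, hD⟩ := GaussoidQuadrics.exists_degree_bound n
    exact ⟨D, fun d hd f hf =>
      ⟨fun h => GaussoidQuadrics.quadricIdeal_le_J n h, fun h => hD d hd f hf h⟩⟩
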